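/- Consider a unit-demand matching market with a finite set $\mathcal{B}$ of buyers, a finite set $\mathcal{M}$ of goods, $|\mathcal{B}|=|\mathcal{M}|$, and valuations $v_{ij}\ge 0$ ($i\in\mathcal{B}$, $j\in\mathcal{M}$). For a price vector $P\in\mathbb{R}^{\mathcal{M}}$, the preference graph joins buyer $i$ and good $j$ if $v_{ij}-P_j\ge 0$ and $v_{ij}-P_j=\max_{k}(v_{ik}-P_k)$. The vector $P$ is market clearing if its preference graph has a perfect matching. Let $N(\cdot)$ denote neighbourhoods in the preference graph. A set $S\subseteq\mathcal{M}$ is a constricted good set if $|S|>|N(S)|$; the skewness of a non-empty $S\subseteq\mathcal{M}$ is $|S|-|N(S)|+\frac{1}{|S|}$, and $S$ is maximally skewed if it maximizes the skewness over all non-empty sets of goods. The skew-aided descending price algorithm starts at $P_j=\max_i v_{ij}$. As long as a constricted good set exists, it takes the maximally skewed set $S$ and lowers the price of every good in $S$ by $$c=\min_{i\in\mathcal{B}\setminus N(S),\ l\in S}\Big\{\max\Big(0,\max_{k\in\mathcal{M}\setminus S}(v_{ik}-P_k)\Big)-(v_{il}-P_l)\Big\};$$ it stops when there is no constricted good set.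 Then the algorithm stops after finitely many rounds. In every round before it stops, the maximally skewed set is unique and is a constricted good set, and $c>0$. The final price vector is non-negative and market clearing, and it is the maximum market-clearing price vector: it is coordinatewise at least as large as every market-clearing price vector. Moreover, at the final prices every non-empty set $A$ of buyers satisfies $|A|<|N^D(A)|$, where $N^D$ is the neighbourhood in the preference graph of the market with one additional dummy good $D$ of price $0$ and of value $0$ to every buyer. -/

import Mathlib

namespace MatchingMarket

noncomputable section

open scoped Classical

/-- The edges of the preference graph. At prices `P`, buyer `b` with valuations `v b` prefers
good `j` if `j` maximizes the surplus `v b j - P j` over all goods and this surplus is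
non-negative. -/
def Prefers {B G : Type*} (v : B → G → ℝ) (P : G → ℝ) (b : B) (j : G) : Prop :=
  0 ≤ v b j - P j ∧ ∀ k, v b k - P k ≤ v b j - P j

/-- `N(S)`: the buyers adjacent to some good of `S` in the preference graph. -/
def buyersOf {B G : Type*} [Fintype B] (v : B → G → ℝ) (P : G → ℝ) (S : Finset G) : Finset B :=
  Finset.univ.filter fun b => ∃ j ∈ S, Prefers v P b j

/-- `N(A)`: the goods adjacent to some buyer of `A` in the preference graph. -/
def goodsOf {B G : Type*} [Fintype G] (v : B → G → ℝ) (P : G → ℝ) (A : Finset B) : Finset G :=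
  Finset.univ.filter fun j => ∃ b ∈ A, Prefers v P b j

/-- `N^D(A)`: the neighbourhood of `A` after adding one dummy good (`none`), which has price
zero and is worth zero to every buyer. -/
def goodsOfWithDummy {B M : Type*} [Fintype M] (v : B → M → ℝ) (P : M → ℝ) (A : Finset B) :
    Finset (Option M) :=
  goodsOf (fun b (j : Option M) => j.elim 0 (v b)) (fun j : Option M => j.elim 0 P) A

/-- A price vector is market clearing if its preference graph has a perfect matching. -/
def IsMarketClearing {B M : Type*} (v : B → M → ℝ) (P : M → ℝ) : Prop :=
  ∃ σ : B ≃ M, ∀ b, Prefers v P b (σ b)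

variable {B M : Type*} [Fintype B] [Fintype M]

/-- A constricted good set: it has strictly more goods than neighbours. -/
def IsConstricted (v : B → M → ℝ) (P : M → ℝ) (S : Finset M) : Prop :=
  (buyersOf v P S).card < S.card

/-- The skewness `|S| - |N(S)| + 1 / |S|` of a non-empty set of goods. -/
def skewness (v : B → M → ℝ) (P : M → ℝ) (S : Finset M) : ℝ :=
  (S.card : ℝ) - ((buyersOf v P S).card : ℝ) + 1 / (S.card : ℝ)

/-- `S` maximizes the skewness among all non-empty sets of goods. -/
def IsMaximallySkewed (v : B → M → ℝ) (P : M → ℝ) (S : Finset M) : Prop :=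
  S.Nonempty ∧ ∀ S' : Finset M, S'.Nonempty → skewness v P S' ≤ skewness v P S

/-- A maximally skewed set (one exists as soon as there is a good). -/
def maximallySkewedSet (v : B → M → ℝ) (P : M → ℝ) : Finset M :=
  if h : ∃ S, IsMaximallySkewed v P S then h.choose else ∅

/-- The best surplus that buyer `b` can get without buying a good of `S`: the maximum of `0`
(not buying) and of the surpluses `v b k - P k` for `k ∉ S`. -/
def outsideSurplus (v : B → M → ℝ) (P : M → ℝ) (S : Finset M) (b : B) : ℝ :=
  (insert 0 ((Finset.univ \ S).image fun k => v b k - P k)).max' (Finset.insert_nonempty _ _)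

/-- The price reduction for the set `S`: the minimum, over buyers `b ∉ N(S)` and goods `l ∈ S`,
of the best surplus of `b` outside `S` minus the surplus of `b` at `l`. For a constricted `S` in
a market with as many buyers as goods the minimum is over a non-empty finite set. -/
def priceReduction (v : B → M → ℝ) (P : M → ℝ) (S : Finset M) : ℝ :=
  sInf {c | ∃ b ∉ buyersOf v P S, ∃ l ∈ S, c = outsideSurplus v P S b - (v b l - P l)}

/-- Lower the prices of all goods of `S` by the price reduction for `S`. -/
def lowerPrices (v : B → M → ℝ) (P : M → ℝ) (S : Finset M) : M → ℝ :=
  fun j => if j ∈ S then P j - priceReduction v P S else P j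

/-- The initial price of a good is the highest valuation that a buyer has for it. -/
def initialPrices (v : B → M → ℝ) : M → ℝ := fun j => ⨆ b, v b j

/-- The stopping condition: there is no constricted good set. -/
def Stops (v : B → M → ℝ) (P : M → ℝ) : Prop := ¬ ∃ S, IsConstricted v P S

/-- One round of the algorithm: unless it stops, it lowers the prices on the maximally skewed
set. -/
def round (v : B → M → ℝ) (P : M → ℝ) : M → ℝ :=
  if Stops v P then P else lowerPrices v P (maximallySkewedSet v P)

/-- The price vector after `t` rounds of the skew-aided descending price algorithm. -/
def prices (v : B → M → ℝ) : ℕ → M → ℝ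
  | 0 => initialPrices v
  | t + 1 => round v (prices v t)

end

end MatchingMarket

/-!
The excess `|S| - |N(S)|` is a supermodular function of `S`, so the sets maximizing it are closed
under intersection. Since `0 < 1 / |S| ≤ 1`, the skewness orders non-empty sets by their excess,
and sets of equal excess by size, the smaller one first. Hence, as long as there is a constricted
set, the unique maximally skewed set `S` is the least maximizer of the excess.

*Termination.* Lowering the prices on `S` destroys only edges from `N(S)` to goods outside `S`,
and it creates an edge from a buyer outside `N(S)` to `S`. Supermodularity then shows that the
maximal skewness strictly decreases, and it takes only finitely many values.

*Maximality.* As `S` is the least maximizer, removing a non-empty `T` from `S` loses fewer than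
`|T|` neighbours. If a round moved exactly the prices of the goods in `T` below a market-clearing
price vector, the buyers matched to `T` would all be lost, which is absurd.

*Neighbourhoods.* The same bound shows that a round preserves the property that every non-empty
set of buyers with positive surplus has more neighbours than members. At the end, a buyer without
positive surplus has the dummy good as an additional neighbour. For the set of all buyers the
inequality forces the dummy good to be a neighbour: some buyer values no good above its price.
-/

namespace MatchingMarket

open Finset

variable {B M : Type*} {v : B → M → ℝ} {P Q : M → ℝ} {S T : Finset M} {A : Finset B}
  {b : B} {j : M}

section Neighbourhoods

theorem mem_buyersOf [Fintype B] : b ∈ buyersOf v P S ↔ ∃ j ∈ S, Prefers v P b j := by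
  simp [buyersOf]

theorem mem_goodsOf [Fintype M] : j ∈ goodsOf v P A ↔ ∃ b ∈ A, Prefers v P b j := by
  simp [goodsOf]

theorem Prefers.mem_buyersOf [Fintype B] (h : Prefers v P b j) (hj : j ∈ S) :
    b ∈ buyersOf v P S :=
  MatchingMarket.mem_buyersOf.2 ⟨j, hj, h⟩

theorem Prefers.mem_goodsOf [Fintype M] (h : Prefers v P b j) (hb : b ∈ A) :
    j ∈ goodsOf v P A :=
  MatchingMarket.mem_goodsOf.2 ⟨b, hb, h⟩

theorem buyersOf_union [DecidableEq B] [DecidableEq M] [Fintype B] (v : B → M → ℝ)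
    (P : M → ℝ) (S T : Finset M) :
    buyersOf v P (S ∪ T) = buyersOf v P S ∪ buyersOf v P T := by
  ext b
  simp only [mem_buyersOf, mem_union, or_and_right, exists_or]

theorem buyersOf_mono [Fintype B] (h : S ⊆ T) : buyersOf v P S ⊆ buyersOf v P T := by
  classical
  rw [← union_eq_right.2 h, buyersOf_union]
  exact subset_union_left

theorem goodsOf_mono [Fintype M] {A' : Finset B} (h : A ⊆ A') :
    goodsOf v P A ⊆ goodsOf v P A' := fun _ hj => by
  obtain ⟨b, hb, hbj⟩ := mem_goodsOf.1 hj
  exact hbj.mem_goodsOf (h hb)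

theorem disjoint_goodsOf [Fintype B] [Fintype M] (h : Disjoint A (buyersOf v P S)) :
    Disjoint (goodsOf v P A) S := by
  refine disjoint_left.2 fun j hj hjS => ?_
  obtain ⟨b, hb, hbj⟩ := mem_goodsOf.1 hj
  exact disjoint_left.1 h hb (hbj.mem_buyersOf hjS)

theorem IsMarketClearing.card_le_card_goodsOf [Fintype M] (hP : IsMarketClearing v P)
    (A : Finset B) : A.card ≤ (goodsOf v P A).card := by
  obtain ⟨σ, hσ⟩ := hP
  exact card_le_card_of_injOn σ (fun b hb => (hσ b).mem_goodsOf hb) σ.injective.injOn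

theorem Stops.isMarketClearing [Fintype B] [Fintype M]
    (hcard : Fintype.card B = Fintype.card M) (hP : Stops v P) : IsMarketClearing v P := by
  classical
  have hHall (S : Finset M) : S.card ≤ (buyersOf v P S).card :=
    not_lt.1 fun hS => hP ⟨S, hS⟩
  obtain ⟨f, hf_inj, hf⟩ :=
    (Fintype.all_card_le_filter_rel_iff_exists_injective fun j b => Prefers v P b j).1
      (by simpa only [buyersOf] using hHall)
  let σ := Equiv.ofBijective f
    ((Fintype.bijective_iff_injective_and_card f).2 ⟨hf_inj, hcard.symm⟩)
  refine ⟨σ.symm, fun b => ?_⟩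
  have hpref : Prefers v P (σ (σ.symm b)) (σ.symm b) := hf (σ.symm b)
  rwa [σ.apply_symm_apply] at hpref

end Neighbourhoods

section Excess

variable [Fintype B]

/-- The excess `|S| - |N(S)|` of a set of goods: the skewness without the tie-breaking term
`1 / |S|`. It is an integer, so there is no truncation. -/
noncomputable def excess (v : B → M → ℝ) (P : M → ℝ) (S : Finset M) : ℤ :=
  (S.card : ℤ) - (buyersOf v P S).card

/-- The sets of goods of maximal excess. The empty set competes, so the maximum is never
negative. -/
def excessMaximizers (v : B → M → ℝ) (P : M → ℝ) : Set (Finset M) :=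
  {S | ∀ T, excess v P T ≤ excess v P S}

theorem excess_empty (v : B → M → ℝ) (P : M → ℝ) : excess v P ∅ = 0 := by
  simp [excess, buyersOf]

theorem isConstricted_iff_excess_pos : IsConstricted v P S ↔ 0 < excess v P S := by
  rw [IsConstricted, excess, sub_pos, Nat.cast_lt]

theorem IsConstricted.nonempty (hS : IsConstricted v P S) : S.Nonempty :=
  card_pos.1 hS.pos

theorem excess_add_excess_le [DecidableEq M] (v : B → M → ℝ) (P : M → ℝ) (S T : Finset M) :
    excess v P S + excess v P T ≤ excess v P (S ∩ T) + excess v P (S ∪ T) := by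
  classical
  have hinter : buyersOf v P (S ∩ T) ⊆ buyersOf v P S ∩ buyersOf v P T :=
    subset_inter (buyersOf_mono inter_subset_left) (buyersOf_mono inter_subset_right)
  have hle := card_le_card hinter
  have hbuyers := card_union_add_card_inter (buyersOf v P S) (buyersOf v P T)
  have hgoods := card_union_add_card_inter S T
  simp only [excess, buyersOf_union]
  omega

theorem inter_mem_excessMaximizers [DecidableEq M] (hS : S ∈ excessMaximizers v P)
    (hT : T ∈ excessMaximizers v P) : S ∩ T ∈ excessMaximizers v P := fun U => by
  have hsuper := excess_add_excess_le v P S T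
  have hunion := hS (S ∪ T)
  have hU := hT U
  omega

theorem isConstricted_of_mem_excessMaximizers (hP : ¬ Stops v P)
    (hS : S ∈ excessMaximizers v P) : IsConstricted v P S := by
  obtain ⟨C, hC⟩ := not_not.1 hP
  exact isConstricted_iff_excess_pos.2 ((isConstricted_iff_excess_pos.1 hC).trans_le (hS C))

theorem card_buyersOf_sdiff_lt [DecidableEq B] [DecidableEq M]
    (hS : IsLeast (excessMaximizers v P) S) (hTS : T ⊆ S) (hT : T.Nonempty) :
    (buyersOf v P S \ buyersOf v P (S \ T)).card < T.card := by
  have hlt : excess v P (S \ T) < excess v P S := by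
    refine (hS.1 _).lt_of_ne fun heq => (sdiff_ssubset hTS hT).2 (hS.2 fun U => ?_)
    rw [heq]
    exact hS.1 U
  have hgoods := card_sdiff_add_card_eq_card hTS
  have hsub : buyersOf v P (S \ T) ⊆ buyersOf v P S := buyersOf_mono sdiff_subset
  have hbuyers := card_sdiff_add_card_eq_card hsub
  simp only [excess] at hlt
  omega

theorem card_lt_card_goodsOf_inter [DecidableEq M] [Fintype M]
    (hS : IsLeast (excessMaximizers v P) S) (hA : A.Nonempty) (hAS : A ⊆ buyersOf v P S) :
    A.card < (goodsOf v P A ∩ S).card := by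
  classical
  obtain ⟨b, hb⟩ := hA
  obtain ⟨j, hj, hbj⟩ := mem_buyersOf.1 (hAS hb)
  have hlost : A ⊆ buyersOf v P S \ buyersOf v P (S \ (goodsOf v P A ∩ S)) := by
    refine fun a ha => mem_sdiff.2 ⟨hAS ha, fun ha' => ?_⟩
    obtain ⟨k, hk, hak⟩ := mem_buyersOf.1 ha'
    obtain ⟨hkS, hk⟩ := mem_sdiff.1 hk
    exact hk (mem_inter.2 ⟨hak.mem_goodsOf ha, hkS⟩)
  exact (card_le_card hlost).trans_lt <| card_buyersOf_sdiff_lt hS inter_subset_right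
    ⟨j, mem_inter.2 ⟨hbj.mem_goodsOf hb, hj⟩⟩

end Excess

section Skewness

variable [Fintype B]

theorem skewness_eq_excess_add (v : B → M → ℝ) (P : M → ℝ) (S : Finset M) :
    skewness v P S = excess v P S + 1 / (S.card : ℝ) := by
  simp [skewness, excess]

theorem skewness_lt_skewness_of_excess_lt (hT : T.Nonempty)
    (h : excess v P S < excess v Q T) : skewness v P S < skewness v Q T := by
  have hle : (excess v P S : ℝ) + 1 ≤ excess v Q T := by exact_mod_cast h
  have hS1 : 1 / (S.card : ℝ) ≤ 1 := by
    simpa using Nat.cast_inv_le_one (α := ℝ) S.card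
  have hT0 : 0 < 1 / (T.card : ℝ) := one_div_pos.2 (by exact_mod_cast hT.card_pos)
  rw [skewness_eq_excess_add, skewness_eq_excess_add]
  linarith

theorem skewness_lt_skewness_of_card_lt (hT : T.Nonempty)
    (h : excess v P S = excess v Q T) (hcard : T.card < S.card) :
    skewness v P S < skewness v Q T := by
  rw [skewness_eq_excess_add, skewness_eq_excess_add, h, add_lt_add_iff_left]
  exact one_div_lt_one_div_of_lt (by exact_mod_cast hT.card_pos) (by exact_mod_cast hcard)

theorem IsMaximallySkewed.mem_excessMaximizers (hS : IsMaximallySkewed v P S)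
    (hP : ¬ Stops v P) : S ∈ excessMaximizers v P := by
  have hle (T : Finset M) (hT : T.Nonempty) : excess v P T ≤ excess v P S :=
    not_lt.1 fun h => (hS.2 T hT).not_gt (skewness_lt_skewness_of_excess_lt hT h)
  obtain ⟨C, hC⟩ := not_not.1 hP
  intro T
  rcases T.eq_empty_or_nonempty with rfl | hT
  · rw [excess_empty]
    exact (isConstricted_iff_excess_pos.1 hC).le.trans (hle C hC.nonempty)
  · exact hle T hT

theorem IsMaximallySkewed.isLeast_excessMaximizers (hS : IsMaximallySkewed v P S)
    (hP : ¬ Stops v P) : IsLeast (excessMaximizers v P) S := by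
  classical
  have hSmax := hS.mem_excessMaximizers hP
  refine ⟨hSmax, fun T hT => ?_⟩
  have hinter := inter_mem_excessMaximizers hSmax hT
  have hne := (isConstricted_of_mem_excessMaximizers hP hinter).nonempty
  have hcard : S.card ≤ (S ∩ T).card := not_lt.1 fun h =>
    (hS.2 _ hne).not_gt
      (skewness_lt_skewness_of_card_lt hne (le_antisymm (hinter S) (hSmax _)) h)
  exact inter_eq_left.1 (eq_of_subset_of_card_le inter_subset_left hcard)

theorem exists_isMaximallySkewed [Finite M] [Nonempty M] (v : B → M → ℝ) (P : M → ℝ) :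
    ∃ S, IsMaximallySkewed v P S := by
  obtain ⟨S, hS, hmax⟩ := Set.exists_max_image {S : Finset M | S.Nonempty} (skewness v P)
    (Set.toFinite _) ⟨_, singleton_nonempty (Classical.arbitrary M)⟩
  exact ⟨S, hS, hmax⟩

theorem isMaximallySkewed_maximallySkewedSet [Fintype M] [Nonempty M] (v : B → M → ℝ)
    (P : M → ℝ) : IsMaximallySkewed v P (maximallySkewedSet v P) := by
  have h := exists_isMaximallySkewed v P
  rw [maximallySkewedSet, dif_pos h]
  exact h.choose_spec

theorem nonempty_of_not_stops (hP : ¬ Stops v P) : Nonempty M := by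
  obtain ⟨C, hC⟩ := not_not.1 hP
  exact hC.nonempty.to_type

theorem existsUnique_isMaximallySkewed [Finite M] (hP : ¬ Stops v P) :
    ∃! S, IsMaximallySkewed v P S := by
  have := nonempty_of_not_stops hP
  obtain ⟨S, hS⟩ := exists_isMaximallySkewed v P
  exact ⟨S, hS, fun T hT =>
    (hT.isLeast_excessMaximizers hP).unique (hS.isLeast_excessMaximizers hP)⟩

theorem isLeast_maximallySkewedSet [Fintype M] (hP : ¬ Stops v P) :
    IsLeast (excessMaximizers v P) (maximallySkewedSet v P) :=
  have := nonempty_of_not_stops hP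
  (isMaximallySkewed_maximallySkewedSet v P).isLeast_excessMaximizers hP

theorem isConstricted_maximallySkewedSet [Fintype M] (hP : ¬ Stops v P) :
    IsConstricted v P (maximallySkewedSet v P) :=
  isConstricted_of_mem_excessMaximizers hP (isLeast_maximallySkewedSet hP).1

theorem finite_setOf_skewness [Finite M] (v : B → M → ℝ) :
    {x | ∃ P S, skewness v P S = x}.Finite := by
  refine (Set.finite_range fun p : Finset M × Finset B =>
    (p.1.card : ℝ) - p.2.card + 1 / (p.1.card : ℝ)).subset ?_
  rintro _ ⟨P, S, rfl⟩
  exact ⟨(S, buyersOf v P S), rfl⟩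

end Skewness

section PriceReduction

variable [Fintype M]

theorem outsideSurplus_le_iff {x : ℝ} :
    outsideSurplus v P S b ≤ x ↔ 0 ≤ x ∧ ∀ k ∉ S, v b k - P k ≤ x := by
  simp [outsideSurplus, max'_le_iff]

variable [Fintype B]

theorem lt_outsideSurplus (hb : b ∉ buyersOf v P S) (hj : j ∈ S) :
    v b j - P j < outsideSurplus v P S b := by
  obtain ⟨m, hm, hmax⟩ := S.exists_max_image (fun k => v b k - P k) ⟨j, hj⟩
  refine (hmax j hj).trans_lt (not_le.1 fun hle => hb ?_)
  obtain ⟨hnonneg, hout⟩ := outsideSurplus_le_iff.1 hle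
  have hpref : Prefers v P b m := ⟨hnonneg, fun k => (em (k ∈ S)).elim (hmax k) (hout k)⟩
  exact hpref.mem_buyersOf hm

theorem finite_setOf_reductions (v : B → M → ℝ) (P : M → ℝ) (S : Finset M) :
    {c | ∃ b ∉ buyersOf v P S, ∃ l ∈ S,
      c = outsideSurplus v P S b - (v b l - P l)}.Finite := by
  refine (Set.finite_range fun p : B × M =>
    outsideSurplus v P S p.1 - (v p.1 p.2 - P p.2)).subset ?_
  rintro c ⟨b, -, l, -, rfl⟩
  exact ⟨(b, l), rfl⟩

theorem add_priceReduction_le_outsideSurplus (hb : b ∉ buyersOf v P S) (hj : j ∈ S) :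
    v b j - P j + priceReduction v P S ≤ outsideSurplus v P S b :=
  le_sub_iff_add_le'.1 <|
    csInf_le (finite_setOf_reductions v P S).bddBelow ⟨b, hb, j, hj, rfl⟩

theorem exists_add_priceReduction_eq_outsideSurplus (hS : S.Nonempty)
    (hN : ∃ b, b ∉ buyersOf v P S) :
    ∃ b ∉ buyersOf v P S, ∃ j ∈ S,
      v b j - P j + priceReduction v P S = outsideSurplus v P S b := by
  obtain ⟨b, hb⟩ := hN
  obtain ⟨j, hj⟩ := hS
  obtain ⟨b', hb', j', hj', heq⟩ :=
    Set.Nonempty.csInf_mem (⟨_, b, hb, j, hj, rfl⟩ : Set.Nonempty {c | ∃ b ∉ buyersOf v P S,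
      ∃ l ∈ S, c = outsideSurplus v P S b - (v b l - P l)}) (finite_setOf_reductions v P S)
  exact ⟨b', hb', j', hj', eq_sub_iff_add_eq'.1 heq⟩

theorem priceReduction_nonneg (v : B → M → ℝ) (P : M → ℝ) (S : Finset M) :
    0 ≤ priceReduction v P S := by
  refine Real.sInf_nonneg ?_
  rintro _ ⟨b, hb, j, hj, rfl⟩
  exact sub_nonneg.2 (lt_outsideSurplus hb hj).le

theorem priceReduction_pos (hS : S.Nonempty) (hN : ∃ b, b ∉ buyersOf v P S) :
    0 < priceReduction v P S := by
  obtain ⟨b, hb, j, hj, heq⟩ := exists_add_priceReduction_eq_outsideSurplus hS hN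
  linarith [lt_outsideSurplus hb hj]

theorem IsConstricted.exists_notMem_buyersOf (hcard : Fintype.card M ≤ Fintype.card B)
    (hS : IsConstricted v P S) : ∃ b, b ∉ buyersOf v P S := by
  by_contra! hall
  have huniv : buyersOf v P S = univ := eq_univ_of_forall hall
  rw [IsConstricted, huniv, card_univ] at hS
  exact (hcard.trans_lt hS).not_ge S.card_le_univ

end PriceReduction

section LowerPrices

variable [Fintype B] [Fintype M]

theorem lowerPrices_of_mem (hj : j ∈ S) :
    lowerPrices v P S j = P j - priceReduction v P S :=
  if_pos hj

theorem lowerPrices_of_notMem (hj : j ∉ S) : lowerPrices v P S j = P j :=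
  if_neg hj

theorem prefers_lowerPrices_of_outsideSurplus_le (hb : b ∉ buyersOf v P S)
    (h : outsideSurplus v P S b ≤ v b j - lowerPrices v P S j) :
    Prefers v (lowerPrices v P S) b j := by
  obtain ⟨hnonneg, hout⟩ := outsideSurplus_le_iff.1 h
  refine ⟨hnonneg, fun k => ?_⟩
  by_cases hk : k ∈ S
  · rw [lowerPrices_of_mem hk]
    linarith [add_priceReduction_le_outsideSurplus hb hk]
  · rw [lowerPrices_of_notMem hk]
    exact hout k hk

theorem sub_lowerPrices_le (v : B → M → ℝ) (P : M → ℝ) (S : Finset M) (b : B) (j : M) :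
    v b j - lowerPrices v P S j ≤ v b j - P j + priceReduction v P S := by
  have hc := priceReduction_nonneg v P S
  by_cases hj : j ∈ S
  · rw [lowerPrices_of_mem hj]
    linarith
  · rw [lowerPrices_of_notMem hj]
    linarith

theorem prefers_lowerPrices (h : Prefers v P b j) (hbj : b ∈ buyersOf v P S → j ∈ S) :
    Prefers v (lowerPrices v P S) b j := by
  have hc := priceReduction_nonneg v P S
  by_cases hj : j ∈ S
  · have hprice := lowerPrices_of_mem (v := v) (P := P) hj
    exact ⟨by linarith [h.1], fun k => by linarith [h.2 k, sub_lowerPrices_le v P S b k]⟩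
  · refine prefers_lowerPrices_of_outsideSurplus_le (mt hbj hj) ?_
    rw [lowerPrices_of_notMem hj]
    exact outsideSurplus_le_iff.2 ⟨h.1, fun k _ => h.2 k⟩

theorem buyersOf_subset_buyersOf_lowerPrices (hTS : T ⊆ S) :
    buyersOf v P T ⊆ buyersOf v (lowerPrices v P S) T := fun b hb => by
  obtain ⟨j, hj, h⟩ := mem_buyersOf.1 hb
  exact (prefers_lowerPrices h fun _ => hTS hj).mem_buyersOf hj

theorem buyersOf_sdiff_subset_buyersOf_lowerPrices [DecidableEq B] (v : B → M → ℝ) (P : M → ℝ)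
    (S T : Finset M) :
    buyersOf v P T \ buyersOf v P S ⊆ buyersOf v (lowerPrices v P S) T := fun b hb => by
  obtain ⟨hbT, hbS⟩ := mem_sdiff.1 hb
  obtain ⟨j, hj, h⟩ := mem_buyersOf.1 hbT
  exact (prefers_lowerPrices h fun hb => absurd hb hbS).mem_buyersOf hj

theorem goodsOf_inter_subset_goodsOf_lowerPrices [DecidableEq M] (v : B → M → ℝ)
    (P : M → ℝ) (S : Finset M) (A : Finset B) :
    goodsOf v P A ∩ S ⊆ goodsOf v (lowerPrices v P S) A := fun j hj => by
  obtain ⟨hjA, hjS⟩ := mem_inter.1 hj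
  obtain ⟨b, hb, h⟩ := mem_goodsOf.1 hjA
  exact (prefers_lowerPrices h fun _ => hjS).mem_goodsOf hb

theorem goodsOf_subset_goodsOf_lowerPrices (hA : Disjoint A (buyersOf v P S)) :
    goodsOf v P A ⊆ goodsOf v (lowerPrices v P S) A := fun j hj => by
  obtain ⟨b, hb, h⟩ := mem_goodsOf.1 hj
  exact (prefers_lowerPrices h fun hbS => absurd hbS (disjoint_left.1 hA hb)).mem_goodsOf hb

end LowerPrices

section Termination

variable [Fintype B] [Fintype M]

theorem exists_mem_buyersOf_lowerPrices (hS : S.Nonempty) (hN : ∃ b, b ∉ buyersOf v P S) :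
    ∃ b ∈ buyersOf v (lowerPrices v P S) S, b ∉ buyersOf v P S := by
  obtain ⟨b, hb, j, hj, heq⟩ := exists_add_priceReduction_eq_outsideSurplus hS hN
  have hpref : Prefers v (lowerPrices v P S) b j := by
    refine prefers_lowerPrices_of_outsideSurplus_le hb ?_
    rw [lowerPrices_of_mem hj]
    linarith
  exact ⟨b, hpref.mem_buyersOf hj, hb⟩

theorem excess_lowerPrices_self_lt (hS : S.Nonempty) (hN : ∃ b, b ∉ buyersOf v P S) :
    excess v (lowerPrices v P S) S < excess v P S := by
  have hss : buyersOf v P S ⊂ buyersOf v (lowerPrices v P S) S :=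
    (ssubset_iff_of_subset (buyersOf_subset_buyersOf_lowerPrices subset_rfl)).2
      (exists_mem_buyersOf_lowerPrices hS hN)
  have hlt := card_lt_card hss
  simp only [excess]
  omega

theorem excess_lowerPrices_add_excess_le [DecidableEq M] (v : B → M → ℝ) (P : M → ℝ)
    (S T : Finset M) :
    excess v (lowerPrices v P S) T + excess v P S ≤
      excess v P (T ∩ S) + excess v P (T ∪ S) := by
  classical
  have hsub : buyersOf v P (T ∩ S) ∪ (buyersOf v P T \ buyersOf v P S) ⊆
      buyersOf v (lowerPrices v P S) T :=
    union_subset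
      ((buyersOf_subset_buyersOf_lowerPrices inter_subset_right).trans
        (buyersOf_mono inter_subset_left))
      (buyersOf_sdiff_subset_buyersOf_lowerPrices v P S T)
  have hdisj : Disjoint (buyersOf v P (T ∩ S)) (buyersOf v P T \ buyersOf v P S) :=
    disjoint_sdiff.mono_left (buyersOf_mono inter_subset_right)
  have hle := card_le_card hsub
  rw [card_union_of_disjoint hdisj] at hle
  have hbuyers := card_sdiff_add_card (buyersOf v P T) (buyersOf v P S)
  have hgoods := card_union_add_card_inter T S
  simp only [excess, buyersOf_union]
  omega

theorem skewness_lowerPrices_lt (hS : IsLeast (excessMaximizers v P) S) (hSne : S.Nonempty)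
    (hN : ∃ b, b ∉ buyersOf v P S) (T : Finset M) :
    skewness v (lowerPrices v P S) T < skewness v P S := by
  classical
  have hsuper := excess_lowerPrices_add_excess_le v P S T
  have hinter := hS.1 (T ∩ S)
  have hunion := hS.1 (T ∪ S)
  have hle : excess v (lowerPrices v P S) T ≤ excess v P S := by omega
  rcases hle.lt_or_eq with hlt | heq
  · exact skewness_lt_skewness_of_excess_lt hSne hlt
  have hST : S ⊆ T := by
    have heq_inter : excess v P (T ∩ S) = excess v P S := by omega
    have hmem : T ∩ S ∈ excessMaximizers v P := fun U => heq_inter ▸ hS.1 U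
    exact (hS.2 hmem).trans inter_subset_left
  have hne : S ≠ T := by
    rintro rfl
    exact (excess_lowerPrices_self_lt hSne hN).ne heq
  exact skewness_lt_skewness_of_card_lt hSne heq (card_lt_card (hST.ssubset_of_ne hne))

theorem prices_succ_of_not_stops {t : ℕ} (ht : ¬ Stops v (prices v t)) :
    prices v (t + 1) =
      lowerPrices v (prices v t) (maximallySkewedSet v (prices v t)) :=
  if_neg ht

theorem exists_stops_prices (hcard : Fintype.card M ≤ Fintype.card B) (v : B → M → ℝ) :
    ∃ t, Stops v (prices v t) := by
  by_contra! hrun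
  let maxSkewness (t : ℕ) : ℝ := skewness v (prices v t) (maximallySkewedSet v (prices v t))
  have hanti : StrictAnti maxSkewness := strictAnti_nat_of_succ_lt fun t => by
    have hcon := isConstricted_maximallySkewedSet (hrun t)
    have hlt := skewness_lowerPrices_lt (isLeast_maximallySkewedSet (hrun t)) hcon.nonempty
      (hcon.exists_notMem_buyersOf hcard) (maximallySkewedSet v (prices v (t + 1)))
    rwa [← prices_succ_of_not_stops (hrun t)] at hlt
  refine Set.infinite_range_of_injective hanti.injective ((finite_setOf_skewness v).subset ?_)
  rintro _ ⟨t, rfl⟩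
  exact ⟨_, _, rfl⟩

end Termination

/-- The strict form of Hall's condition for the buyers with positive surplus: every non-empty
set of them has more neighbours than members. It is an invariant of the algorithm, whereas the
inequality with the dummy good holds only at the end. -/
def StrictHall [Fintype M] (v : B → M → ℝ) (P : M → ℝ) : Prop :=
  ∀ A : Finset B, A.Nonempty → (∀ b ∈ A, ∃ k, P k < v b k) → A.card < (goodsOf v P A).card

section InitialPrices

variable [Finite B]

theorem le_initialPrices (v : B → M → ℝ) (b : B) (j : M) :
    v b j ≤ initialPrices v j :=
  le_ciSup (f := fun b => v b j) (Set.finite_range _).bddAbove b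

theorem IsMarketClearing.le_initialPrices (hQ : IsMarketClearing v Q) :
    Q ≤ initialPrices v := fun j => by
  obtain ⟨σ, hσ⟩ := hQ
  have hprice : Q (σ (σ.symm j)) ≤ v (σ.symm j) (σ (σ.symm j)) := sub_nonneg.1 (hσ _).1
  rw [σ.apply_symm_apply] at hprice
  exact hprice.trans (MatchingMarket.le_initialPrices v _ j)

theorem strictHall_initialPrices [Fintype M] (v : B → M → ℝ) : StrictHall v (initialPrices v) := by
  rintro A ⟨b, hb⟩ hpos
  obtain ⟨k, hk⟩ := hpos b hb
  exact absurd (le_initialPrices v b k) hk.not_ge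

end InitialPrices

section Invariants

variable [Fintype B] [Fintype M]

theorem prices_induction {p : (M → ℝ) → Prop} (hinit : p (initialPrices v))
    (hlower : ∀ P S, IsLeast (excessMaximizers v P) S → p P → p (lowerPrices v P S)) (t : ℕ) :
    p (prices v t) := by
  induction t with
  | zero => exact hinit
  | succ t ih =>
    by_cases ht : Stops v (prices v t)
    · rwa [prices, round, if_pos ht]
    · rw [prices_succ_of_not_stops ht]
      exact hlower _ _ (isLeast_maximallySkewedSet ht) ih

theorem Prefers.mem_buyersOf_of_lowerPrices_lt (h : Prefers v Q b j) (hQP : Q ≤ P)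
    (hj : j ∈ S) (hlt : lowerPrices v P S j < Q j) : b ∈ buyersOf v P S := by
  by_contra hb
  rw [lowerPrices_of_mem hj] at hlt
  have hout : outsideSurplus v P S b ≤ v b j - Q j :=
    outsideSurplus_le_iff.2 ⟨h.1, fun k _ => by linarith [h.2 k, hQP k]⟩
  linarith [add_priceReduction_le_outsideSurplus hb hj]

theorem Prefers.not_prefers_of_lowerPrices_lt {k : M} (h : Prefers v Q b j) (hj : j ∈ S)
    (hlt : lowerPrices v P S j < Q j) (hk : k ∈ S) (hle : Q k ≤ lowerPrices v P S k) :
    ¬ Prefers v P b k := fun hbk => by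
  rw [lowerPrices_of_mem hj] at hlt
  rw [lowerPrices_of_mem hk] at hle
  linarith [hbk.2 j, h.2 k]

theorem IsMarketClearing.le_lowerPrices (hQ : IsMarketClearing v Q)
    (hS : IsLeast (excessMaximizers v P) S) (hQP : Q ≤ P) : Q ≤ lowerPrices v P S := by
  classical
  obtain ⟨σ, hσ⟩ := hQ
  have hσ' (j : M) : Prefers v Q (σ.symm j) j := by simpa using hσ (σ.symm j)
  by_contra hnot
  obtain ⟨j, hj⟩ : ∃ j, lowerPrices v P S j < Q j := by simpa [Pi.le_def] using hnot
  let T := S.filter fun k => lowerPrices v P S k < Q k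
  have hjS : j ∈ S := by
    by_contra hjS
    rw [lowerPrices_of_notMem hjS] at hj
    exact hj.not_ge (hQP j)
  have hlost : ∀ k ∈ T, σ.symm k ∈ buyersOf v P S \ buyersOf v P (S \ T) := by
    intro k hk
    obtain ⟨hkS, hklt⟩ := mem_filter.1 hk
    refine mem_sdiff.2
      ⟨(hσ' k).mem_buyersOf_of_lowerPrices_lt hQP hkS hklt, fun hmem => ?_⟩
    obtain ⟨l, hl, hpref⟩ := mem_buyersOf.1 hmem
    obtain ⟨hlS, hlT⟩ := mem_sdiff.1 hl
    have hle : Q l ≤ lowerPrices v P S l := not_lt.1 fun hlt => hlT (mem_filter.2 ⟨hlS, hlt⟩)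
    exact (hσ' k).not_prefers_of_lowerPrices_lt hkS hklt hlS hle hpref
  have hlt := card_buyersOf_sdiff_lt hS (show T ⊆ S from filter_subset _ S)
    ⟨j, mem_filter.2 ⟨hjS, hj⟩⟩
  exact hlt.not_ge (card_le_card_of_injOn σ.symm hlost σ.symm.injective.injOn)

theorem IsMarketClearing.le_prices (hQ : IsMarketClearing v Q) (t : ℕ) : Q ≤ prices v t :=
  prices_induction (p := fun P => Q ≤ P) hQ.le_initialPrices
    (fun _ _ hS hQP => hQ.le_lowerPrices hS hQP) t

theorem exists_lt_of_exists_lowerPrices_lt (hb : b ∉ buyersOf v P S)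
    (h : ∃ k, lowerPrices v P S k < v b k) : ∃ k, P k < v b k := by
  by_contra! hle
  have hout : outsideSurplus v P S b ≤ 0 :=
    outsideSurplus_le_iff.2 ⟨le_rfl, fun k _ => sub_nonpos.2 (hle k)⟩
  obtain ⟨k, hk⟩ := h
  by_cases hkS : k ∈ S
  · rw [lowerPrices_of_mem hkS] at hk
    linarith [add_priceReduction_le_outsideSurplus hb hkS]
  · rw [lowerPrices_of_notMem hkS] at hk
    exact hk.not_ge (hle k)

theorem strictHall_lowerPrices (hP : StrictHall v P) (hS : IsLeast (excessMaximizers v P) S) :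
    StrictHall v (lowerPrices v P S) := by
  classical
  intro A hA hpos
  let A₁ := A ∩ buyersOf v P S
  let A₂ := A \ buyersOf v P S
  have hA₂ : Disjoint A₂ (buyersOf v P S) := sdiff_disjoint
  have h₁ (h : A₁.Nonempty) : A₁.card < (goodsOf v P A₁ ∩ S).card :=
    card_lt_card_goodsOf_inter hS h inter_subset_right
  have h₂ (h : A₂.Nonempty) : A₂.card < (goodsOf v P A₂).card :=
    hP A₂ h fun b hb =>
      exists_lt_of_exists_lowerPrices_lt (disjoint_left.1 hA₂ hb) (hpos b (sdiff_subset hb))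
  have hsub : (goodsOf v P A₁ ∩ S) ∪ goodsOf v P A₂ ⊆
      goodsOf v (lowerPrices v P S) A :=
    union_subset
      ((goodsOf_inter_subset_goodsOf_lowerPrices v P S A₁).trans (goodsOf_mono inter_subset_left))
      ((goodsOf_subset_goodsOf_lowerPrices hA₂).trans (goodsOf_mono sdiff_subset))
  have hdisj : Disjoint (goodsOf v P A₁ ∩ S) (goodsOf v P A₂) :=
    (disjoint_goodsOf hA₂).symm.mono_left inter_subset_right
  have hle := card_le_card hsub
  rw [card_union_of_disjoint hdisj] at hle
  have hcard : A₁.card + A₂.card = A.card := card_inter_add_card_sdiff A (buyersOf v P S)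
  have hApos := hA.card_pos
  rw [← card_pos] at h₁ h₂
  omega

theorem strictHall_prices (v : B → M → ℝ) (t : ℕ) : StrictHall v (prices v t) :=
  prices_induction (strictHall_initialPrices v) (fun _ _ hS hP => strictHall_lowerPrices hP hS) t

end Invariants

section DummyGood

variable [Fintype M]

theorem eraseNone_goodsOfWithDummy (v : B → M → ℝ) (P : M → ℝ) (A : Finset B) :
    eraseNone (goodsOfWithDummy v P A) = goodsOf v P A := by
  ext j
  simp +contextual [goodsOfWithDummy, mem_goodsOf, Prefers, Option.forall]

theorem none_mem_goodsOfWithDummy :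
    none ∈ goodsOfWithDummy v P A ↔ ∃ b ∈ A, ∀ j, v b j ≤ P j := by
  simp [goodsOfWithDummy, mem_goodsOf, Prefers, Option.forall]

theorem card_goodsOf_le_card_goodsOfWithDummy (v : B → M → ℝ) (P : M → ℝ) (A : Finset B) :
    (goodsOf v P A).card ≤ (goodsOfWithDummy v P A).card :=
  eraseNone_goodsOfWithDummy v P A ▸ card_eraseNone_le _

theorem card_goodsOf_lt_card_goodsOfWithDummy (h : ∃ b ∈ A, ∀ j, v b j ≤ P j) :
    (goodsOf v P A).card < (goodsOfWithDummy v P A).card := by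
  have hnone := none_mem_goodsOfWithDummy.2 h
  rw [← eraseNone_goodsOfWithDummy, card_eraseNone_of_mem hnone]
  exact Nat.sub_one_lt_of_lt (card_pos.2 ⟨_, hnone⟩)

theorem StrictHall.card_lt_card_goodsOfWithDummy (hH : StrictHall v P)
    (hP : IsMarketClearing v P) (hA : A.Nonempty) :
    A.card < (goodsOfWithDummy v P A).card := by
  by_cases hpos : ∀ b ∈ A, ∃ k, P k < v b k
  · exact (hH A hA hpos).trans_le (card_goodsOf_le_card_goodsOfWithDummy v P A)
  · push Not at hpos
    exact (hP.card_le_card_goodsOf A).trans_lt (card_goodsOf_lt_card_goodsOfWithDummy hpos)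

theorem exists_forall_le_of_card_lt_card_goodsOfWithDummy (hcard : Fintype.card M ≤ A.card)
    (hA : A.card < (goodsOfWithDummy v P A).card) : ∃ b ∈ A, ∀ j, v b j ≤ P j := by
  by_contra h
  rw [← card_eraseNone_of_not_mem (mt none_mem_goodsOfWithDummy.1 h),
    eraseNone_goodsOfWithDummy] at hA
  exact (hcard.trans_lt hA).not_ge (card_le_univ _)

theorem nonneg_of_card_lt_card_goodsOfWithDummy [Fintype B]
    (hcard : Fintype.card M ≤ Fintype.card B) (hv : ∀ b j, 0 ≤ v b j)
    (hA : ∀ A : Finset B, A.Nonempty → A.card < (goodsOfWithDummy v P A).card) (j : M) :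
    0 ≤ P j := by
  have : Nonempty B := Fintype.card_pos_iff.1 ((Fintype.card_pos_iff.2 ⟨j⟩).trans_le hcard)
  obtain ⟨b, -, hb⟩ :=
    exists_forall_le_of_card_lt_card_goodsOfWithDummy hcard (hA univ univ_nonempty)
  exact (hv b j).trans (hb j)

end DummyGood

end MatchingMarket

theorem mainTheorem1_general {B M : Type*} [Fintype B] [Fintype M]
    (hcard : Fintype.card B = Fintype.card M)
    (v : B → M → ℝ) :
    ∃ T : ℕ,
      (∀ t < T, ¬ MatchingMarket.Stops v (MatchingMarket.prices v t) ∧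
        (∃! S, MatchingMarket.IsMaximallySkewed v (MatchingMarket.prices v t) S) ∧
        MatchingMarket.IsConstricted v (MatchingMarket.prices v t)
          (MatchingMarket.maximallySkewedSet v (MatchingMarket.prices v t)) ∧
        0 < MatchingMarket.priceReduction v (MatchingMarket.prices v t)
          (MatchingMarket.maximallySkewedSet v (MatchingMarket.prices v t))) ∧
      MatchingMarket.Stops v (MatchingMarket.prices v T) ∧
      IsGreatest {P : M → ℝ | MatchingMarket.IsMarketClearing v P} (MatchingMarket.prices v T) ∧
      ∀ A : Finset B, A.Nonempty →
        A.card < (MatchingMarket.goodsOfWithDummy v (MatchingMarket.prices v T) A).card := by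
  classical
  have hterminates := MatchingMarket.exists_stops_prices hcard.ge v
  have hclear := (Nat.find_spec hterminates).isMarketClearing hcard
  refine ⟨Nat.find hterminates, fun t ht => ?_, Nat.find_spec hterminates,
    ⟨hclear, fun Q hQ => hQ.le_prices _⟩, fun A hA =>
      (MatchingMarket.strictHall_prices v _).card_lt_card_goodsOfWithDummy hclear hA⟩
  have hrun := Nat.find_min hterminates ht
  have hcon := MatchingMarket.isConstricted_maximallySkewedSet hrun
  exact ⟨hrun, MatchingMarket.existsUnique_isMaximallySkewed hrun, hcon,
    MatchingMarket.priceReduction_pos hcon.nonempty (hcon.exists_notMem_buyersOf hcard.ge)⟩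

theorem mainTheorem1 {B M : Type*} [Fintype B] [Fintype M]
    (hcard : Fintype.card B = Fintype.card M)
    (v : B → M → ℝ) (hv : ∀ b j, 0 ≤ v b j) :
    ∃ T : ℕ,
      -- before time `T` the algorithm runs, and the set that it uses is well defined
      (∀ t < T, ¬ MatchingMarket.Stops v (MatchingMarket.prices v t) ∧
        (∃! S, MatchingMarket.IsMaximallySkewed v (MatchingMarket.prices v t) S) ∧
        MatchingMarket.IsConstricted v (MatchingMarket.prices v t)
          (MatchingMarket.maximallySkewedSet v (MatchingMarket.prices v t)) ∧
        0 < MatchingMarket.priceReduction v (MatchingMarket.prices v t)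
          (MatchingMarket.maximallySkewedSet v (MatchingMarket.prices v t))) ∧
      -- at time `T` it stops, at the maximum market-clearing price vector
      MatchingMarket.Stops v (MatchingMarket.prices v T) ∧
      IsGreatest {P : M → ℝ | MatchingMarket.IsMarketClearing v P} (MatchingMarket.prices v T) ∧
      (∀ j, 0 ≤ MatchingMarket.prices v T j) ∧
      -- the neighbourhood inequality at termination
      ∀ A : Finset B, A.Nonempty →
        A.card < (MatchingMarket.goodsOfWithDummy v (MatchingMarket.prices v T) A).card := by
  obtain ⟨T, hrun, hterminates, hgreatest, hA⟩ := mainTheorem1_general hcard v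
  exact ⟨T, hrun, hterminates, hgreatest,
    MatchingMarket.nonneg_of_card_lt_card_goodsOfWithDummy hcard.ge hv hA, hA⟩
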